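/- Let $\mathbb{F}$ be the category of finite sets, $\mathbb{S}$ the category of sets, $i:\mathbb{F}\to\mathbb{S}$ the inclusion and $1$ a one-point set. Equip the functor category $[\mathbb{F},\mathbb{S}]$ with the substitution monoidal structure, with tensor and unit $$(F\circ G)(X)=\int^{C\in\mathbb{F}} F C\times (C\to G X),\qquad i.$$ A strong endoprofunctor is a functor $P:\mathbb{F}^{\mathrm{op}}\times\mathbb{F}\to\mathbb{S}$ together with maps $\mathrm{str}_{X,Y,Z}:P(X,Y)\to P(X\times Z,Y\times Z)$, natural in $X,Y$ and dinatural in $Z$, such that $P(\mathrm{id},\pi_1)\circ\mathrm{str}_{X,Y,1}=P(\pi_1,\mathrm{id})$ and $\mathrm{str}_{X\times V,Y\times V,W}\circ\mathrm{str}_{X,Y,V}=P(\alpha^{-1},\alpha)\circ\mathrm{str}_{X,Y,V\times W}$, where $\alpha:A\times(B\times C)\cong(A\times B)\times C$. Let $\mathrm{Prof}_s$ be the category of strong endoprofunctors and strength-preserving natural transformations, equipped with Bénabou's monoidal structure $$(P\otimes Q)(X,Y)=\int^{W\in\mathbb{F}} P(X,W)\times Q(W,Y),\qquad \mathrm{str}^{P\otimes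 Q}_{X,Y,Z}\circ\iota_W=\iota_{W\times Z}\circ(\mathrm{str}^P_{X,W,Z}\times\mathrm{str}^Q_{W,Y,Z}),$$ where $\iota_W$ are the coend injections, with unit $\mathrm{Hom}$, whose strength is $f\mapsto f\times\mathrm{id}_Z$. Let $(-)^*:\mathrm{Prof}_s\to[\mathbb{F},\mathbb{S}]$ be the restriction functor $P^*(Z)=P(1,Z)$, and let $(-)_*:[\mathbb{F},\mathbb{S}]\to\mathrm{Prof}_s$ be the Kleisli functor $F_*(X,Y)=(X\to FY)$, with strength $f\mapsto\big((x,z)\mapsto F(y\mapsto(y,z))(f(x))\big)$. The Kleisli adjunction is $(-)^*\dashv(-)_*$, with unit $\eta_P:P(X,Y)\to(X\to P(1,Y))$, $p\mapsto(x\mapsto P(x,\mathrm{id}_Y)(p))$ (where $x\in X$ is regarded as a map $1\to X$), and counit $(1\to FZ)\to FZ$ given by evaluation at the point of $1$. Then the Kleisli functor $(-)_*$ is (lax) monoidal, say with structure $\xi_{F,G}:F_*\otimes G_*\to(F\circ G)_*$, $\xi_0:\mathrm{Hom}\to i_*$; the restriction functor $(-)^*$ is opmonoidal, say with structure $\varphi_{P,Q}:(P\otimes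 Q)^*\to P^*\circ Q^*$, $\varphi_0:\mathrm{Hom}^*\to i$; and these structures can be chosen so that the Kleisli adjunction is a colax-lax monoidal adjunction, i.e. for all strong endoprofunctors $P,Q$ $$(\varphi_0)_*\circ\eta_{\mathrm{Hom}}=\xi_0,\qquad (\varphi_{P,Q})_*\circ\eta_{P\otimes Q}=\xi_{P^*,Q^*}\circ(\eta_P\otimes\eta_Q).$$ -/

import Mathlib

open CategoryTheory Limits MonoidalCategory Opposite
open scoped CategoryTheory.Prod

universe u

namespace FinComp

/-! ### Coends over finite sets -/

/-- Coends over finite sets exist in sets: finite sets form an essentially small category. -/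
instance hasCoend (T : FintypeCat.{u}ᵒᵖ ⥤ FintypeCat.{u} ⥤ Type u) : HasCoend T := by
  refine (Types.hasColimit_iff_small_colimitType _).2 ?_
  refine small_of_surjective
    (α := Σ n : ULift.{u} ℕ, (T.obj (op (FintypeCat.of (ULift.{u} (Fin n.down))))).obj
      (FintypeCat.of (ULift.{u} (Fin n.down))))
    (f := fun x => Functor.ιColimitType (multispanIndexCoend T).multispan
      (WalkingMultispan.right (J := multispanShapeCoend FintypeCat.{u})
        (FintypeCat.of (ULift.{u} (Fin x.1.down)))) x.2) ?_
  have key : ∀ (C : FintypeCat.{u}) (t : (T.obj (op C)).obj C), ∃ x : (Σ n : ULift.{u} ℕ,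
      (T.obj (op (FintypeCat.of (ULift.{u} (Fin n.down))))).obj
      (FintypeCat.of (ULift.{u} (Fin n.down)))),
      Functor.ιColimitType (multispanIndexCoend T).multispan
      (WalkingMultispan.right (J := multispanShapeCoend FintypeCat.{u})
        (FintypeCat.of (ULift.{u} (Fin x.1.down)))) x.2 =
      Functor.ιColimitType (multispanIndexCoend T).multispan
        (WalkingMultispan.right (J := multispanShapeCoend FintypeCat.{u}) C) t := by
    intro C t
    let D : FintypeCat.{u} := FintypeCat.of (ULift.{u} (Fin (Nat.card C)))
    let e : C ≃ D := (Finite.equivFin C).trans Equiv.ulift.symm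
    let i : C ≅ D := FintypeCat.equivEquivIso e
    let s : (T.obj (op D)).obj C := (T.map i.inv.op).app C t
    refine ⟨⟨⟨Nat.card C⟩, (T.obj (op D)).map i.hom s⟩, ?_⟩
    have h1 := Functor.ιColimitType_map (multispanIndexCoend T).multispan
      (WalkingMultispan.Hom.fst (J := multispanShapeCoend FintypeCat.{u}) (Arrow.mk i.hom)) s
    have h2 := Functor.ιColimitType_map (multispanIndexCoend T).multispan
      (WalkingMultispan.Hom.snd (J := multispanShapeCoend FintypeCat.{u}) (Arrow.mk i.hom)) s
    have h3 : (T.map i.hom.op).app C s = t := by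
      change (T.map i.hom.op).app C ((T.map i.inv.op).app C t) = t
      rw [← NatTrans.comp_app_apply, ← Functor.map_comp, ← op_comp, i.hom_inv_id]
      simp
    refine h2.trans (h1.symm.trans ?_)
    exact congrArg _ h3
  intro z
  obtain ⟨j, z, rfl⟩ := Functor.ιColimitType_jointly_surjective _ z
  cases j with
  | right C => exact key C z
  | left a =>
    obtain ⟨x, hx⟩ := key _ ((multispanIndexCoend T).multispan.map
      (WalkingMultispan.Hom.fst (J := multispanShapeCoend FintypeCat.{u}) a) z)
    exact ⟨x, hx.trans (Functor.ιColimitType_map _ _ _)⟩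

/-- The functor `(W', W) ↦ A W × B W'`. -/
def integrand (A : FintypeCat.{u} ⥤ Type u) (B : FintypeCat.{u}ᵒᵖ ⥤ Type u) :
    FintypeCat.{u}ᵒᵖ ⥤ FintypeCat.{u} ⥤ Type u where
  obj W' :=
    { obj := fun W => A.obj W × B.obj W'
      map := fun f => TypeCat.ofHom fun x => (A.map f x.1, x.2)
      map_id := by intro X; ext x <;> simp
      map_comp := by intro X Y Z f g; ext x <;> simp }
  map g :=
    { app := fun W => TypeCat.ofHom fun x => (x.1, B.map g x.2)
      naturality := by intro X Y f; ext x <;> simp }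
  map_id := by intro X; ext Y x <;> simp
  map_comp := by intro X Y Z f g; ext W x <;> simp

/-- The coend `∫^W A W × B W`. -/
noncomputable def FTensor (A : FintypeCat.{u} ⥤ Type u) (B : FintypeCat.{u}ᵒᵖ ⥤ Type u) : Type u :=
  coend (integrand A B)

namespace FTensor

variable {A A' : FintypeCat.{u} ⥤ Type u} {B B' : FintypeCat.{u}ᵒᵖ ⥤ Type u}

/-- The coend injection `ι_W : A W × B W → ∫^W A W × B W`. -/
noncomputable def mk (W : FintypeCat.{u}) (a : A.obj W) (b : B.obj (op W)) : FTensor A B :=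
  coend.ι (integrand A B) W (a, b)

theorem sound {V W : FintypeCat.{u}} (f : V ⟶ W) (a : A.obj V) (b : B.obj (op W)) :
    (mk W (A.map f a) b : FTensor A B) = mk V a (B.map f.op b) :=
  (types_congr_hom (coend.condition (integrand A B) f) (a, b)).symm

/-- The map out of the coend given by its universal property. -/
noncomputable def lift {Z : Type u} (φ : ∀ W : FintypeCat.{u}, A.obj W → B.obj (op W) → Z)
    (hφ : ∀ (V W : FintypeCat.{u}) (f : V ⟶ W) (a : A.obj V) (b : B.obj (op W)),
      φ W (A.map f a) b = φ V a (B.map f.op b)) : FTensor A B → Z :=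
  coend.desc (F := integrand A B) (X := Z) (fun W => TypeCat.ofHom fun x => φ W x.1 x.2)
    (by intro V W f; ext x; exact (hφ V W f x.1 x.2).symm)

@[simp]
theorem lift_mk {Z : Type u} (φ : ∀ W : FintypeCat.{u}, A.obj W → B.obj (op W) → Z)
    (hφ : ∀ (V W : FintypeCat.{u}) (f : V ⟶ W) (a : A.obj V) (b : B.obj (op W)),
      φ W (A.map f a) b = φ V a (B.map f.op b)) (W : FintypeCat.{u}) (a : A.obj W)
    (b : B.obj (op W)) : lift φ hφ (mk W a b) = φ W a b :=
  types_congr_hom (coend.ι_desc (F := integrand A B) (X := Z)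
    (fun W => TypeCat.ofHom fun x => φ W x.1 x.2) _ W) (a, b)

theorem ind {p : FTensor A B → Prop} (h : ∀ W a b, p (mk W a b)) (x : FTensor A B) : p x := by
  have : (TypeCat.ofHom (fun x => ULift.up (p x)) : coend (integrand A B) ⟶ ULift.{u} Prop) =
      TypeCat.ofHom (fun _ => ULift.up True) := by
    apply coend.hom_ext
    intro W
    ext ⟨a, b⟩
    exact iff_of_true (h W a b) trivial
  exact of_eq_true (congrArg ULift.down (types_congr_hom this x))

/-- Functoriality of the coend. -/
noncomputable def map (α : A ⟶ A') (β : B ⟶ B') : FTensor A B → FTensor A' B' :=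
  lift (fun W a b => mk W (α.app W a) (β.app (op W) b)) (by
    intro V W f a b
    rw [NatTrans.naturality_apply, sound, NatTrans.naturality_apply])

@[simp]
theorem map_mk (α : A ⟶ A') (β : B ⟶ B') (W : FintypeCat.{u}) (a : A.obj W) (b : B.obj (op W)) :
    map α β (mk W a b) = mk W (α.app W a) (β.app (op W) b) :=
  lift_mk _ _ _ _ _

end FTensor

/-! ### Finitary functors and the substitution product -/

/-- The category `[𝔽, 𝕊]` of functors from finite sets to sets. It is a synonym of the functor
category, so that it can carry the substitution monoidal structure. -/
def FinFun : Type (u + 1) := FintypeCat.{u} ⥤ Type u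

namespace FinFun

instance : Category.{u + 1} FinFun.{u} := inferInstanceAs (Category (FintypeCat.{u} ⥤ Type u))

/-- The value of a finitary functor. -/
abbrev obj (F : FinFun.{u}) (X : FintypeCat.{u}) : Type u := CategoryTheory.Functor.obj F X

/-- The action of a finitary functor on a function. -/
abbrev map (F : FinFun.{u}) {X Y : FintypeCat.{u}} (f : X ⟶ Y) : F.obj X → F.obj Y :=
  fun x => CategoryTheory.Functor.map F f x

theorem map_id (F : FinFun.{u}) {X : FintypeCat.{u}} (x : F.obj X) : F.map (𝟙 X) x = x :=
  CategoryTheory.Functor.map_id_apply F X x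

theorem map_comp (F : FinFun.{u}) {X Y Z : FintypeCat.{u}} (f : X ⟶ Y) (g : Y ⟶ Z) (x : F.obj X) :
    F.map (f ≫ g) x = F.map g (F.map f x) :=
  CategoryTheory.Functor.map_comp_apply F f g x

/-- The component of a natural transformation, as a function. -/
def app {F G : FinFun.{u}} (τ : F ⟶ G) (X : FintypeCat.{u}) : F.obj X → G.obj X :=
  fun x => NatTrans.app τ X x

theorem naturality {F G : FinFun.{u}} (τ : F ⟶ G) {X Y : FintypeCat.{u}} (f : X ⟶ Y)
    (x : F.obj X) : app τ Y (F.map f x) = G.map f (app τ X x) :=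
  NatTrans.naturality_apply (F := F) (G := G) τ f x

theorem hom_ext {F G : FinFun.{u}} {σ τ : F ⟶ G} (h : ∀ X x, app σ X x = app τ X x) : σ = τ :=
  NatTrans.ext (F := F) (G := G) (by funext X; ext x; exact h X x)

@[simp]
theorem id_app (F : FinFun.{u}) (X : FintypeCat.{u}) (x : F.obj X) : app (𝟙 F) X x = x := rfl

@[simp]
theorem comp_app {F G H : FinFun.{u}} (σ : F ⟶ G) (τ : G ⟶ H) (X : FintypeCat.{u}) (x : F.obj X) :
    app (σ ≫ τ) X x = app τ X (app σ X x) := rfl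

/-- A finitary functor from its action on elements. -/
def mk (obj : FintypeCat.{u} → Type u) (map : ∀ {X Y : FintypeCat.{u}}, (X ⟶ Y) → obj X → obj Y)
    (map_id : ∀ X x, map (𝟙 X) x = x)
    (map_comp : ∀ {X Y Z : FintypeCat.{u}} (f : X ⟶ Y) (g : Y ⟶ Z) x,
      map (f ≫ g) x = map g (map f x)) : FinFun.{u} :=
  ({ obj := obj
     map := fun f => TypeCat.ofHom (map f)
     map_id := fun X => by ext x; exact map_id X x
     map_comp := fun f g => by ext x; exact map_comp f g x } : FintypeCat.{u} ⥤ Type u)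

/-- A natural transformation from its components. -/
def homMk {F G : FinFun.{u}} (app : ∀ X, F.obj X → G.obj X)
    (nat : ∀ (X Y : FintypeCat.{u}) (f : X ⟶ Y) (x : F.obj X),
      app Y (F.map f x) = G.map f (app X x)) : F ⟶ G :=
  ({ app := fun X => TypeCat.ofHom (app X)
     naturality := fun X Y f => by ext x; exact nat X Y f x } :
    NatTrans (C := FintypeCat.{u}) (D := Type u) F G)

@[simp]
theorem homMk_app {F G : FinFun.{u}} (a : ∀ X, F.obj X → G.obj X)
    (nat : ∀ (X Y : FintypeCat.{u}) (f : X ⟶ Y) (x : F.obj X),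
      a Y (F.map f x) = G.map f (a X x)) (X : FintypeCat.{u}) (x : F.obj X) :
    app (homMk a nat) X x = a X x := rfl

/-- A natural isomorphism from a natural transformation and pointwise inverses. -/
def isoMk {F G : FinFun.{u}} (τ : F ⟶ G) (inv : ∀ X, G.obj X → F.obj X)
    (h₁ : ∀ X x, inv X (app τ X x) = x) (h₂ : ∀ X y, app τ X (inv X y) = y) : F ≅ G where
  hom := τ
  inv := homMk inv (fun X Y f y => by
    rw [← h₁ Y (F.map f (inv X y)), naturality, h₂])
  hom_inv_id := hom_ext fun X x => h₁ X x
  inv_hom_id := hom_ext fun X x => h₂ X x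

@[simp]
theorem isoMk_hom {F G : FinFun.{u}} (τ : F ⟶ G) (inv : ∀ X, G.obj X → F.obj X)
    (h₁ : ∀ X x, inv X (app τ X x) = x) (h₂ : ∀ X y, app τ X (inv X y) = y) :
    (isoMk τ inv h₁ h₂).hom = τ := rfl

/-- The inclusion `i : 𝔽 → 𝕊`. -/
def incl : FinFun.{u} := FintypeCat.incl.{u}

/-- The functor `C ↦ (C → Z)`. -/
def pow (Z : Type u) : FintypeCat.{u}ᵒᵖ ⥤ Type u where
  obj C := C.unop → Z
  map f := TypeCat.ofHom fun h c => h (f.unop c)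

/-- Postcomposition `(C → Z) → (C → Z')`, natural in `C`. -/
def powMap {Z Z' : Type u} (k : Z → Z') : pow Z ⟶ pow Z' where
  app C := TypeCat.ofHom fun h c => k (h c)

/-- The set `∫^C F C × (C → Z)`. -/
noncomputable abbrev Ext (F : FinFun.{u}) (Z : Type u) : Type u := FTensor F (pow Z)

/-- The class of `(a, h)` in `∫^C F C × (C → Z)`. -/
noncomputable def emk {F : FinFun.{u}} {Z : Type u} (C : FintypeCat.{u}) (a : F.obj C) (h : C → Z) :
    Ext F Z := FTensor.mk (A := F) (B := pow Z) C a h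

theorem emk_map {F : FinFun.{u}} {Z : Type u} {C D : FintypeCat.{u}} (f : C ⟶ D) (a : F.obj C)
    (h : D → Z) : emk D (F.map f a) h = emk C a (fun c => h (f c)) :=
  FTensor.sound (A := F) (B := pow Z) f a h

theorem eind {F : FinFun.{u}} {Z : Type u} {p : Ext F Z → Prop}
    (h : ∀ C (a : F.obj C) (k : C → Z), p (emk C a k)) (x : Ext F Z) : p x :=
  FTensor.ind h x

/-- Maps out of `∫^C F C × (C → Z)`. -/
noncomputable def elift {F : FinFun.{u}} {Z Y : Type u}
    (φ : ∀ C : FintypeCat.{u}, F.obj C → (C → Z) → Y)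
    (hφ : ∀ (C D : FintypeCat.{u}) (f : C ⟶ D) (a : F.obj C) (h : D → Z),
      φ D (F.map f a) h = φ C a (fun c => h (f c))) : Ext F Z → Y :=
  FTensor.lift (A := F) (B := pow Z) φ (hφ)

@[simp]
theorem elift_emk {F : FinFun.{u}} {Z Y : Type u}
    (φ : ∀ C : FintypeCat.{u}, F.obj C → (C → Z) → Y)
    (hφ : ∀ (C D : FintypeCat.{u}) (f : C ⟶ D) (a : F.obj C) (h : D → Z),
      φ D (F.map f a) h = φ C a (fun c => h (f c))) (C : FintypeCat.{u}) (a : F.obj C) (h : C → Z) :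
    elift φ hφ (emk C a h) = φ C a h :=
  FTensor.lift_mk (A := F) (B := pow Z) φ _ C a h

/-- The map `∫^C F C × (C → Z) → ∫^C F' C × (C → Z')` induced by `τ : F ⟶ F'` and `k : Z → Z'`. -/
noncomputable def emap {F F' : FinFun.{u}} (τ : F ⟶ F') {Z Z' : Type u} (k : Z → Z') :
    Ext F Z → Ext F' Z' :=
  FTensor.map τ (powMap k)

@[simp]
theorem emap_emk {F F' : FinFun.{u}} (τ : F ⟶ F') {Z Z' : Type u} (k : Z → Z') (C : FintypeCat.{u})
    (a : F.obj C) (h : C → Z) : emap τ k (emk C a h) = emk C (app τ C a) (fun c => k (h c)) :=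
  FTensor.map_mk _ _ _ _ _

/-- The substitution product `(F ∘ G) X = ∫^C F C × (C → G X)`. -/
noncomputable def subst (F G : FinFun.{u}) : FinFun.{u} :=
  mk (fun X => Ext F (G.obj X)) (fun f => emap (𝟙 F) (G.map f))
    (fun X x => by
      induction x using eind with
      | h C a k => simp [map_id])
    (fun f g x => by
      induction x using eind with
      | h C a k => simp [map_comp])

/-- The class of `(a, h)` in `(F ∘ G) X`. -/
noncomputable def smk {F G : FinFun.{u}} {X : FintypeCat.{u}} (C : FintypeCat.{u}) (a : F.obj C)
    (h : C → G.obj X) : (subst F G).obj X := emk C a h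

theorem smk_map {F G : FinFun.{u}} {X C D : FintypeCat.{u}} (f : C ⟶ D) (a : F.obj C)
    (h : D → G.obj X) : smk D (F.map f a) h = smk C a (fun c => h (f c)) :=
  emk_map f a h

theorem sind {F G : FinFun.{u}} {X : FintypeCat.{u}} {p : (subst F G).obj X → Prop}
    (h : ∀ C (a : F.obj C) (k : C → G.obj X), p (smk C a k)) (x : (subst F G).obj X) : p x :=
  eind h x

/-- Maps out of `(F ∘ G) X`. -/
noncomputable def slift {F G : FinFun.{u}} {X : FintypeCat.{u}} {Y : Type u}
    (φ : ∀ C : FintypeCat.{u}, F.obj C → (C → G.obj X) → Y)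
    (hφ : ∀ (C D : FintypeCat.{u}) (f : C ⟶ D) (a : F.obj C) (h : D → G.obj X),
      φ D (F.map f a) h = φ C a (fun c => h (f c))) : (subst F G).obj X → Y :=
  elift φ hφ

@[simp]
theorem slift_smk {F G : FinFun.{u}} {X : FintypeCat.{u}} {Y : Type u}
    (φ : ∀ C : FintypeCat.{u}, F.obj C → (C → G.obj X) → Y)
    (hφ : ∀ (C D : FintypeCat.{u}) (f : C ⟶ D) (a : F.obj C) (h : D → G.obj X),
      φ D (F.map f a) h = φ C a (fun c => h (f c))) (C : FintypeCat.{u}) (a : F.obj C)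
    (h : C → G.obj X) : slift φ hφ (smk C a h) = φ C a h :=
  elift_emk φ hφ C a h

@[simp]
theorem subst_map_smk {F G : FinFun.{u}} {X Y : FintypeCat.{u}} (f : X ⟶ Y) (C : FintypeCat.{u})
    (a : F.obj C) (h : C → G.obj X) :
    (subst F G).map f (smk C a h) = smk C a (fun c => G.map f (h c)) :=
  emap_emk (𝟙 F) (G.map f) C a h

/-- Functoriality of the substitution product. -/
noncomputable def substMap {F F' G G' : FinFun.{u}} (σ : F ⟶ F') (τ : G ⟶ G') :
    subst F G ⟶ subst F' G' :=
  homMk (fun X => slift (fun C a h => smk C (app σ C a) (fun c => app τ X (h c)))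
      (fun _ _ f a h => by rw [naturality, smk_map]))
    (fun X Y f x => by
      induction x using sind with
      | h C a k => simp [naturality])

@[simp]
theorem substMap_smk {F F' G G' : FinFun.{u}} (σ : F ⟶ F') (τ : G ⟶ G') (X C : FintypeCat.{u})
    (a : F.obj C) (h : C → G.obj X) :
    app (substMap σ τ) X (smk C a h) = smk C (app σ C a) (fun c => app τ X (h c)) := by
  rw [substMap, homMk_app, slift_smk]

/-! #### Elements of `∫^C F C × (C → Z)`: common representatives and equality -/

/-- Corestriction of a map to a finite subset containing its image. -/
def cod {C : FintypeCat.{u}} {Z : Type u} (S : Set Z) [Finite S] (h : C → Z) (hS : ∀ c, h c ∈ S) :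
    C ⟶ FintypeCat.of S := FintypeCat.homMk fun c => ⟨h c, hS c⟩

theorem emk_cod {F : FinFun.{u}} {Z : Type u} {C : FintypeCat.{u}} (S : Set Z) [Finite S]
    (a : F.obj C) (h : C → Z) (hS : ∀ c, h c ∈ S) :
    emk (FintypeCat.of S) (F.map (cod S h hS) a) Subtype.val = emk C a h :=
  emk_map _ _ _

/-- Two representatives agree after passing to a finite subset. -/
def Agree {F : FinFun.{u}} {Z : Type u} {C C' : FintypeCat.{u}} (a : F.obj C) (h : C → Z)
    (a' : F.obj C') (h' : C' → Z) : Prop :=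
  ∃ (S : Set Z) (_ : Finite S) (hS : ∀ c, h c ∈ S) (hS' : ∀ c, h' c ∈ S),
    F.map (cod S h hS) a = F.map (cod S h' hS') a'

theorem agree_mono {F : FinFun.{u}} {Z : Type u} {C C' : FintypeCat.{u}} {a : F.obj C} {h : C → Z}
    {a' : F.obj C'} {h' : C' → Z} {S T : Set Z} [Finite S] [Finite T] (hST : S ⊆ T)
    (hS : ∀ c, h c ∈ S) (hS' : ∀ c, h' c ∈ S)
    (e : F.map (cod S h hS) a = F.map (cod S h' hS') a') :
    F.map (cod T h fun c => hST (hS c)) a = F.map (cod T h' fun c => hST (hS' c)) a' := by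
  let j : FintypeCat.of S ⟶ FintypeCat.of T := FintypeCat.homMk fun s => ⟨s.1, hST s.2⟩
  have := congrArg (F.map j) e
  rw [← map_comp, ← map_comp] at this
  exact this

theorem agree_of_eq {F : FinFun.{u}} {Z : Type u} {C C' : FintypeCat.{u}} {a : F.obj C} {h : C → Z}
    {a' : F.obj C'} {h' : C' → Z} (e : emk C a h = emk C' a' h') : Agree a h a' h' := by
  let φ : Ext F Z → ULift.{u} Prop := elift (fun D b k => ULift.up (Agree a h b k)) (by
    intro D E f b k
    congr 1
    apply propext
    constructor
    · rintro ⟨S, _, hS, hS', e⟩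
      refine ⟨S, inferInstance, hS, fun c => hS' (f c), e.trans ?_⟩
      rw [← map_comp]
      rfl
    · rintro ⟨S, _, hS, hS', e⟩
      refine ⟨S ∪ Set.range k, inferInstance, fun c => Or.inl (hS c),
        fun c => Or.inr ⟨c, rfl⟩, ?_⟩
      rw [← map_comp]
      exact agree_mono Set.subset_union_left hS hS' e)
  have h1 : (φ (emk C a h)).down := by
    simp only [φ, elift_emk]
    exact ⟨Set.range h, inferInstance, fun c => ⟨c, rfl⟩, fun c => ⟨c, rfl⟩, rfl⟩
  rw [e] at h1
  simpa only [φ, elift_emk] using h1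

theorem exists_common {F : FinFun.{u}} {Z : Type u} {D : FintypeCat.{u}} (k : D → Ext F Z) :
    ∃ (C : FintypeCat.{u}) (g : D → F.obj C) (h : C → Z), ∀ d, emk C (g d) h = k d := by
  have key : ∀ x : Ext F Z, ∃ (C : FintypeCat.{u}) (a : F.obj C) (h : C → Z), emk C a h = x :=
    by
    intro x
    induction x using eind with
    | h C a h => exact ⟨C, a, h, rfl⟩
  choose C a h e using fun d => key (k d)
  let j : ∀ d, C d ⟶ FintypeCat.of (Σ d, C d) := fun d => FintypeCat.homMk fun c => ⟨d, c⟩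
  refine ⟨FintypeCat.of (Σ d, C d), fun d => F.map (j d) (a d), fun x => h x.1 x.2, fun d => ?_⟩
  rw [emk_map]
  exact e d

theorem exists_common' {F G : FinFun.{u}} {X D : FintypeCat.{u}} (k : D → (subst F G).obj X) :
    ∃ (C : FintypeCat.{u}) (g : D → F.obj C) (h : C → G.obj X), ∀ d, smk C (g d) h = k d :=
  exists_common k

theorem smk_cod {F G : FinFun.{u}} {X C : FintypeCat.{u}} (S : Set (G.obj X)) [Finite S]
    (a : F.obj C) (h : C → G.obj X) (hS : ∀ c, h c ∈ S) :
    smk (FintypeCat.of S) (F.map (cod S h hS) a) Subtype.val = smk C a h :=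
  emk_cod S a h hS

theorem assoc_indep {F G H : FinFun.{u}} {X D C C' : FintypeCat.{u}} (f : F.obj D)
    (g : D → G.obj C) (h : C → H.obj X) (g' : D → G.obj C') (h' : C' → H.obj X)
    (e : ∀ d, smk C (g d) h = smk C' (g' d) h') :
    smk C (smk D f g) h = smk C' (smk D f g') h' := by
  choose S hf hS hS' hh using fun d => agree_of_eq (e d)
  let T : Set (H.obj X) := (Set.range h ∪ Set.range h') ∪ ⋃ d, S d
  have hT : ∀ c, h c ∈ T := fun c => Or.inl (Or.inl ⟨c, rfl⟩)
  have hT' : ∀ c, h' c ∈ T := fun c => Or.inl (Or.inr ⟨c, rfl⟩)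
  rw [← smk_cod T _ h hT, ← smk_cod T _ h' hT', subst_map_smk, subst_map_smk]
  congr 2
  funext d
  exact agree_mono (T := T) (fun z hz => Or.inr (Set.mem_iUnion.2 ⟨d, hz⟩)) (hS d) (hS' d) (hh d)

/-- The associator `(F ∘ G) ∘ H ⟶ F ∘ (G ∘ H)`,
`[C, [D, f, g], h] ↦ [D, f, d ↦ [C, g d, h]]`. -/
noncomputable def assocHom (F G H : FinFun.{u}) :
    subst (subst F G) H ⟶ subst F (subst G H) :=
  homMk (fun X => slift (fun C x h => slift (fun D f g => smk D f fun d => smk C (g d) h)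
        (fun _ _ k a g => by rw [smk_map]) x)
      (fun _ _ k x h => by
        induction x using sind with
        | h E f g => simp [smk_map]))
    (fun X Y k x => by
      induction x using sind with
      | h C x h =>
        induction x using sind with
        | h D f g => simp)

@[simp]
theorem assocHom_smk {F G H : FinFun.{u}} (X C D : FintypeCat.{u}) (f : F.obj D) (g : D → G.obj C)
    (h : C → H.obj X) :
    app (assocHom F G H) X (smk C (smk D f g) h) = smk D f (fun d => smk C (g d) h) := by
  rw [assocHom, homMk_app, slift_smk, slift_smk]

/-- The inverse of the associator: a finite family in `∫^C G C × (C → Z)` has a common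
representing `C`. -/
noncomputable def assocInv (F G H : FinFun.{u}) (X : FintypeCat.{u}) :
    (subst F (subst G H)).obj X → (subst (subst F G) H).obj X :=
  slift (fun D f k => smk (exists_common' k).choose
      (smk D f (exists_common' k).choose_spec.choose)
      (exists_common' k).choose_spec.choose_spec.choose)
    (fun C D u f k => by
      rw [smk_map]
      apply assoc_indep
      intro d
      rw [(exists_common' k).choose_spec.choose_spec.choose_spec,
        (exists_common' fun c => k (u c)).choose_spec.choose_spec.choose_spec])

theorem assocInv_smk {F G H : FinFun.{u}} {X : FintypeCat.{u}} (D C : FintypeCat.{u}) (f : F.obj D)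
    (g : D → G.obj C) (h : C → H.obj X) :
    assocInv F G H X (smk D f fun d => smk C (g d) h) = smk C (smk D f g) h := by
  refine (slift_smk _ _ _ _ _).trans ?_
  apply assoc_indep
  intro d
  rw [(exists_common' fun d => smk C (g d) h).choose_spec.choose_spec.choose_spec]

/-- The associator of the substitution product. -/
noncomputable def assocIso (F G H : FinFun.{u}) :
    subst (subst F G) H ≅ subst F (subst G H) :=
  isoMk (assocHom F G H) (fun X => assocInv F G H X)
    (fun X x => by
      induction x using sind with
      | h C x h =>
        induction x using sind with
        | h D f g => rw [assocHom_smk, assocInv_smk])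
    (fun X x => by
      induction x using sind with
      | h D f k =>
        obtain ⟨C, g, h, e⟩ := exists_common' k
        obtain rfl : (fun d => smk C (g d) h) = k := funext e
        rw [assocInv_smk, assocHom_smk])

@[simp]
theorem assocIso_smk {F G H : FinFun.{u}} (X C D : FintypeCat.{u}) (f : F.obj D) (g : D → G.obj C)
    (h : C → H.obj X) :
    app (assocIso F G H).hom X (smk C (smk D f g) h) = smk D f (fun d => smk C (g d) h) :=
  assocHom_smk X C D f g h

/-- An element of `X` as an element of `i X`. -/
def toIncl {X : FintypeCat.{u}} (x : X) : incl.obj X := x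

/-- An element of `i X` as an element of `X`. -/
def ofIncl {X : FintypeCat.{u}} (x : incl.obj X) : X := x

@[simp]
theorem ofIncl_toIncl {X : FintypeCat.{u}} (x : X) : ofIncl (toIncl x) = x := rfl

@[simp]
theorem toIncl_ofIncl {X : FintypeCat.{u}} (x : incl.obj X) : toIncl (ofIncl x) = x := rfl

@[simp]
theorem ofIncl_map {X Y : FintypeCat.{u}} (f : X ⟶ Y) (x : incl.obj X) :
    ofIncl (incl.map f x) = f (ofIncl x) := rfl

@[simp]
theorem incl_map_toIncl {X Y : FintypeCat.{u}} (f : X ⟶ Y) (x : X) :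
    incl.map f (toIncl x) = toIncl (f x) := rfl

/-- The left unitor `i ∘ G ≅ G`, `[C, c, g] ↦ g c`. -/
noncomputable def leftIso (G : FinFun.{u}) : subst incl G ≅ G :=
  isoMk
    (homMk (fun X => slift (fun C c g => g (ofIncl c)) (fun _ _ f a h => by rw [ofIncl_map]))
      (fun X Y f x => by
        induction x using sind with
        | h C a k => simp))
    (fun X x => smk (FintypeCat.of PUnit.{u + 1}) (toIncl PUnit.unit) fun _ => x)
    (fun X x => by
      induction x using sind with
      | h C a k =>
        simp only [homMk_app, slift_smk]
        exact (smk_map (F := incl) (FintypeCat.homMk fun _ : PUnit.{u + 1} => ofIncl a :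
          FintypeCat.of PUnit.{u + 1} ⟶ C) (toIncl PUnit.unit) k).symm)
    (fun X y => by simp)

@[simp]
theorem leftIso_smk {G : FinFun.{u}} (X C : FintypeCat.{u}) (c : incl.obj C) (g : C → G.obj X) :
    app (leftIso G).hom X (smk C c g) = g (ofIncl c) := by
  rw [leftIso, isoMk_hom, homMk_app, slift_smk]

/-- The right unitor `F ∘ i ≅ F`, `[C, f, h] ↦ F(h)(f)`. -/
noncomputable def rightIso (F : FinFun.{u}) : subst F incl ≅ F :=
  isoMk
    (homMk (fun X => slift (fun C a h => F.map (FintypeCat.homMk fun c => ofIncl (h c)) a)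
        (fun _ _ f a h => by rw [← map_comp]; rfl))
      (fun X Y f x => by
        induction x using sind with
        | h C a k =>
          rw [subst_map_smk, slift_smk, slift_smk, ← map_comp]
          rfl))
    (fun X x => smk X x fun c => toIncl c)
    (fun X x => by
      induction x using sind with
      | h C a k =>
        rw [homMk_app, slift_smk, smk_map]
        rfl)
    (fun X y => by
      rw [homMk_app, slift_smk]
      exact F.map_id y)

@[simp]
theorem rightIso_smk {F : FinFun.{u}} (X C : FintypeCat.{u}) (a : F.obj C) (h : C → incl.obj X) :
    app (rightIso F).hom X (smk C a h) = F.map (FintypeCat.homMk fun c => ofIncl (h c)) a := by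
  rw [rightIso, isoMk_hom, homMk_app, slift_smk]

/-- The substitution monoidal structure `([𝔽, 𝕊], ∘, i)`. -/
noncomputable instance : MonoidalCategory FinFun.{u} where
  tensorObj := subst
  whiskerLeft F _ _ τ := substMap (𝟙 F) τ
  whiskerRight σ G := substMap σ (𝟙 G)
  tensorHom := substMap
  tensorUnit := incl
  associator := assocIso
  leftUnitor := leftIso
  rightUnitor := rightIso
  tensorHom_def σ τ := hom_ext fun X x => by
    induction x using sind with
    | h C a k => simp only [comp_app, substMap_smk, id_app]
  id_tensorHom_id F G := hom_ext fun X x => by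
    induction x using sind with
    | h C a k => exact substMap_smk _ _ _ _ _ _
  tensorHom_comp_tensorHom σ τ σ' τ' := hom_ext fun X x => by
    induction x using sind with
    | h C a k => simp only [comp_app, substMap_smk]
  whiskerLeft_id F G := hom_ext fun X x => by
    induction x using sind with
    | h C a k => exact substMap_smk _ _ _ _ _ _
  id_whiskerRight F G := hom_ext fun X x => by
    induction x using sind with
    | h C a k => exact substMap_smk _ _ _ _ _ _
  associator_naturality σ τ ρ := hom_ext fun X x => by
    induction x using sind with
    | h C x h =>
      induction x using sind with
      | h D f g => simp only [comp_app, substMap_smk, assocIso_smk]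
  leftUnitor_naturality τ := hom_ext fun X x => by
    induction x using sind with
    | h C a k => simp only [comp_app, substMap_smk, id_app, leftIso_smk]
  rightUnitor_naturality τ := hom_ext fun X x => by
    induction x using sind with
    | h C a k => simp only [comp_app, substMap_smk, id_app, rightIso_smk, naturality]
  pentagon F G H K := hom_ext fun X x => by
    induction x using sind with
    | h C x h =>
      induction x using sind with
      | h D x h =>
        induction x using sind with
        | h E f g => simp only [comp_app, substMap_smk, id_app, assocIso_smk]
  triangle F G := hom_ext fun X x => by
    induction x using sind with
    | h C x h =>
      induction x using sind with
      | h D f g =>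
        simp only [comp_app, substMap_smk, id_app, assocIso_smk, leftIso_smk, rightIso_smk, smk_map]
        rfl

end FinFun

/-! ### Strong endoprofunctors on finite sets -/

/-- The cartesian product of finite sets. -/
abbrev prod (X Z : FintypeCat.{u}) : FintypeCat.{u} := FintypeCat.of (X × Z)

/-- The terminal object `1`. -/
abbrev one : FintypeCat.{u} := FintypeCat.of PUnit.{u + 1}

/-- `f × g`. -/
def prodMap {X X' Z Z' : FintypeCat.{u}} (f : X ⟶ X') (g : Z ⟶ Z') : prod X Z ⟶ prod X' Z' :=
  FintypeCat.homMk fun x => (f x.1, g x.2)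

/-- The first projection. -/
def fst (X Z : FintypeCat.{u}) : prod X Z ⟶ X := FintypeCat.homMk fun x => x.1

/-- `α : A × (B × C) → (A × B) × C`. -/
def assoc (A B C : FintypeCat.{u}) : prod A (prod B C) ⟶ prod (prod A B) C :=
  FintypeCat.homMk fun x => ((x.1, x.2.1), x.2.2)

/-- `α⁻¹ : (A × B) × C → A × (B × C)`. -/
def assocInv (A B C : FintypeCat.{u}) : prod (prod A B) C ⟶ prod A (prod B C) :=
  FintypeCat.homMk fun x => (x.1.1, (x.1.2, x.2))

/-- Endoprofunctors on finite sets. -/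
abbrev FinProf : Type (u + 1) := FintypeCat.{u}ᵒᵖ × FintypeCat.{u} ⥤ Type u

namespace FinProf

/-- `P(X, Y)`. -/
abbrev el (P : FinProf.{u}) (X Y : FintypeCat.{u}) : Type u := P.obj (op X, Y)

/-- `P(f, g) : P(X, Y) → P(X', Y')` for `f : X' → X` and `g : Y → Y'`. -/
def bimap (P : FinProf.{u}) {X X' Y Y' : FintypeCat.{u}} (f : X' ⟶ X) (g : Y ⟶ Y') :
    P.el X Y → P.el X' Y' := fun p => P.map (f.op ×ₘ g) p

theorem bimap_id (P : FinProf.{u}) {X Y : FintypeCat.{u}} (p : P.el X Y) :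
    P.bimap (𝟙 X) (𝟙 Y) p = p :=
  CategoryTheory.Functor.map_id_apply P (op X, Y) p

theorem bimap_bimap (P : FinProf.{u}) {X X' X'' Y Y' Y'' : FintypeCat.{u}} (f : X' ⟶ X) (g : Y ⟶ Y')
    (f' : X'' ⟶ X') (g' : Y' ⟶ Y'') (p : P.el X Y) :
    P.bimap f' g' (P.bimap f g p) = P.bimap (f' ≫ f) (g ≫ g') p :=
  (CategoryTheory.Functor.map_comp_apply P (X := (op X, Y)) (Y := (op X', Y')) (Z := (op X'', Y''))
    (f.op ×ₘ g) (f'.op ×ₘ g') p).symm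

/-- An endoprofunctor from its action on elements. -/
def mk (el : FintypeCat.{u} → FintypeCat.{u} → Type u)
    (bimap : ∀ {X X' Y Y' : FintypeCat.{u}}, (X' ⟶ X) → (Y ⟶ Y') → el X Y → el X' Y')
    (bimap_id : ∀ X Y p, bimap (𝟙 X) (𝟙 Y) p = p)
    (bimap_bimap : ∀ {X X' X'' Y Y' Y'' : FintypeCat.{u}} (f : X' ⟶ X) (g : Y ⟶ Y')
      (f' : X'' ⟶ X') (g' : Y' ⟶ Y'') (p : el X Y),
      bimap f' g' (bimap f g p) = bimap (f' ≫ f) (g ≫ g') p) : FinProf.{u} where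
  obj A := el A.1.unop A.2
  map f := TypeCat.ofHom (bimap f.1.unop f.2)
  map_id A := by ext p; exact bimap_id A.1.unop A.2 p
  map_comp f g := by ext p; exact (bimap_bimap f.1.unop f.2 g.1.unop g.2 p).symm

/-- The component of a natural transformation, as a function. -/
def app {P Q : FinProf.{u}} (τ : P ⟶ Q) (X Y : FintypeCat.{u}) : P.el X Y → Q.el X Y :=
  fun p => NatTrans.app τ (op X, Y) p

theorem naturality {P Q : FinProf.{u}} (τ : P ⟶ Q) {X X' Y Y' : FintypeCat.{u}} (f : X' ⟶ X)
    (g : Y ⟶ Y') (p : P.el X Y) : app τ X' Y' (P.bimap f g p) = Q.bimap f g (app τ X Y p) :=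
  NatTrans.naturality_apply τ (X := (op X, Y)) (Y := (op X', Y')) (f.op ×ₘ g) p

/-- The functor `W ↦ P(X, W)`. -/
def left (P : FinProf.{u}) (X : FintypeCat.{u}) : FintypeCat.{u} ⥤ Type u where
  obj W := P.el X W
  map f := TypeCat.ofHom (P.bimap (𝟙 X) f)
  map_id W := by ext p; exact P.bimap_id p
  map_comp f g := by
    ext p
    exact (P.bimap_bimap (𝟙 X) f (𝟙 X) g p).symm

/-- The functor `W ↦ P(W, Y)`. -/
def right (P : FinProf.{u}) (Y : FintypeCat.{u}) : FintypeCat.{u}ᵒᵖ ⥤ Type u where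
  obj W := P.el W.unop Y
  map f := TypeCat.ofHom (P.bimap f.unop (𝟙 Y))
  map_id W := by ext p; exact P.bimap_id p
  map_comp f g := by
    ext p
    exact (P.bimap_bimap f.unop (𝟙 Y) g.unop (𝟙 Y) p).symm

/-- The set `(P ⊗ Q)(X, Y) = ∫^W P(X, W) × Q(W, Y)`. -/
noncomputable def Ten (P Q : FinProf.{u}) (X Y : FintypeCat.{u}) : Type u :=
  FTensor (P.left X) (Q.right Y)

/-- The coend injection `ι_W : P(X, W) × Q(W, Y) → (P ⊗ Q)(X, Y)`. -/
noncomputable def tmk {P Q : FinProf.{u}} {X Y : FintypeCat.{u}} (W : FintypeCat.{u}) (p : P.el X W)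
    (q : Q.el W Y) : Ten P Q X Y := FTensor.mk (A := P.left X) (B := Q.right Y) W p q

theorem tmk_bimap {P Q : FinProf.{u}} {X Y V W : FintypeCat.{u}} (f : V ⟶ W) (p : P.el X V)
    (q : Q.el W Y) : tmk W (P.bimap (𝟙 X) f p) q = tmk V p (Q.bimap f (𝟙 Y) q) :=
  FTensor.sound (A := P.left X) (B := Q.right Y) f p q

theorem tind {P Q : FinProf.{u}} {X Y : FintypeCat.{u}} {r : Ten P Q X Y → Prop}
    (h : ∀ W (p : P.el X W) (q : Q.el W Y), r (tmk W p q)) (x : Ten P Q X Y) : r x :=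
  FTensor.ind h x

/-- Maps out of `(P ⊗ Q)(X, Y)`. -/
noncomputable def tlift {P Q : FinProf.{u}} {X Y : FintypeCat.{u}} {Z : Type u}
    (φ : ∀ W : FintypeCat.{u}, P.el X W → Q.el W Y → Z)
    (hφ : ∀ (V W : FintypeCat.{u}) (f : V ⟶ W) (p : P.el X V) (q : Q.el W Y),
      φ W (P.bimap (𝟙 X) f p) q = φ V p (Q.bimap f (𝟙 Y) q)) : Ten P Q X Y → Z :=
  FTensor.lift (A := P.left X) (B := Q.right Y) φ hφ

@[simp]
theorem tlift_tmk {P Q : FinProf.{u}} {X Y : FintypeCat.{u}} {Z : Type u}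
    (φ : ∀ W : FintypeCat.{u}, P.el X W → Q.el W Y → Z)
    (hφ : ∀ (V W : FintypeCat.{u}) (f : V ⟶ W) (p : P.el X V) (q : Q.el W Y),
      φ W (P.bimap (𝟙 X) f p) q = φ V p (Q.bimap f (𝟙 Y) q)) (W : FintypeCat.{u}) (p : P.el X W)
    (q : Q.el W Y) : tlift φ hφ (tmk W p q) = φ W p q :=
  FTensor.lift_mk (A := P.left X) (B := Q.right Y) φ hφ W p q

/-- `P(f, -) ⊗ Q(-, g)`. -/
noncomputable def tbimap {P Q : FinProf.{u}} {X X' Y Y' : FintypeCat.{u}} (f : X' ⟶ X)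
    (g : Y ⟶ Y') : Ten P Q X Y → Ten P Q X' Y' :=
  tlift (fun W p q => tmk W (P.bimap f (𝟙 W) p) (Q.bimap (𝟙 W) g q)) (by
    intro V W k p q
    rw [bimap_bimap, bimap_bimap, Category.comp_id, Category.comp_id, Category.id_comp,
      Category.id_comp]
    have h := tmk_bimap (P := P) (Q := Q) k (P.bimap f (𝟙 V) p) (Q.bimap (𝟙 W) g q)
    rw [bimap_bimap, bimap_bimap, Category.comp_id, Category.comp_id, Category.id_comp,
      Category.id_comp] at h
    exact h)

@[simp]
theorem tbimap_tmk {P Q : FinProf.{u}} {X X' Y Y' : FintypeCat.{u}} (f : X' ⟶ X)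
    (g : Y ⟶ Y') (W : FintypeCat.{u}) (p : P.el X W) (q : Q.el W Y) :
    tbimap f g (tmk W p q) = tmk W (P.bimap f (𝟙 W) p) (Q.bimap (𝟙 W) g q) :=
  tlift_tmk _ _ _ _ _

/-- Bénabou's tensor `(P ⊗ Q)(X, Y) = ∫^W P(X, W) × Q(W, Y)`. -/
noncomputable def tensor (P Q : FinProf.{u}) : FinProf.{u} :=
  mk (Ten P Q) tbimap
    (fun X Y x => by
      induction x using tind with
      | h W p q => rw [tbimap_tmk, bimap_id, bimap_id])
    (fun f g f' g' x => by
      induction x using tind with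
      | h W p q => simp only [tbimap_tmk, bimap_bimap, Category.comp_id])

theorem tensor_bimap {P Q : FinProf.{u}} {X X' Y Y' : FintypeCat.{u}} (f : X' ⟶ X)
    (g : Y ⟶ Y') (x : Ten P Q X Y) : (tensor P Q).bimap f g x = tbimap f g x := rfl

/-- The profunctor `Hom`. -/
def hom : FinProf.{u} :=
  mk (fun X Y => X ⟶ Y) (fun f g h => f ≫ h ≫ g) (fun _ _ _ => by simp)
    (fun _ _ _ _ _ => by simp)

/-- The profunctor `(X, Y) ↦ (i X → F Y)`. -/
def kleisli (F : FinFun.{u}) : FinProf.{u} :=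
  mk (fun X Y => X → F.obj Y) (fun f g h x => F.map g (h (f x)))
    (fun _ _ _ => funext fun _ => F.map_id _)
    (fun _ _ _ _ _ => funext fun _ => (F.map_comp _ _ _).symm)

end FinProf

/-- A (right) strong endoprofunctor on finite sets: the strength is natural in `X`, `Y`, dinatural
in `Z`, and compatible with `1` and `×`. -/
structure StrongProf : Type (u + 1) where
  /-- The underlying endoprofunctor. -/
  prof : FinProf.{u}
  /-- The strength `P(X, Y) → P(X × Z, Y × Z)`. -/
  str : ∀ X Y Z : FintypeCat.{u}, prof.el X Y → prof.el (prod X Z) (prod Y Z)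
  str_natural : ∀ {X X' Y Y' : FintypeCat.{u}} (Z : FintypeCat.{u}) (f : X' ⟶ X) (g : Y ⟶ Y')
    (p : prof.el X Y), str X' Y' Z (prof.bimap f g p) =
      prof.bimap (prodMap f (𝟙 Z)) (prodMap g (𝟙 Z)) (str X Y Z p)
  str_dinatural : ∀ (X Y : FintypeCat.{u}) {Z Z' : FintypeCat.{u}} (h : Z ⟶ Z') (p : prof.el X Y),
    prof.bimap (𝟙 (prod X Z)) (prodMap (𝟙 Y) h) (str X Y Z p) =
      prof.bimap (prodMap (𝟙 X) h) (𝟙 (prod Y Z')) (str X Y Z' p)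
  str_one : ∀ (X Y : FintypeCat.{u}) (p : prof.el X Y),
    prof.bimap (𝟙 (prod X one)) (fst Y one) (str X Y one p) = prof.bimap (fst X one) (𝟙 Y) p
  str_str : ∀ (X Y V W : FintypeCat.{u}) (p : prof.el X Y),
    str (prod X V) (prod Y V) W (str X Y V p) =
      prof.bimap (assocInv X V W) (assoc Y V W) (str X Y (prod V W) p)

namespace StrongProf

open FinProf

/-- Strong natural transformations. -/
@[ext]
structure Hom (P Q : StrongProf.{u}) : Type (u + 1) where
  /-- The underlying natural transformation. -/
  nat : P.prof ⟶ Q.prof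
  nat_str : ∀ (X Y Z : FintypeCat.{u}) (p : P.prof.el X Y),
    FinProf.app nat (prod X Z) (prod Y Z) (P.str X Y Z p) = Q.str X Y Z (FinProf.app nat X Y p)

/-- The category `Prof_s` of strong endoprofunctors and strong natural transformations. -/
instance : Category.{u + 1} StrongProf.{u} where
  Hom := Hom
  id P := ⟨𝟙 P.prof, fun _ _ _ _ => rfl⟩
  comp σ τ := ⟨σ.nat ≫ τ.nat, fun X Y Z p =>
    (congrArg (FinProf.app τ.nat (prod X Z) (prod Y Z)) (σ.nat_str X Y Z p)).trans
      (τ.nat_str X Y Z _)⟩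
  id_comp σ := Hom.ext (Category.id_comp σ.nat)
  comp_id σ := Hom.ext (Category.comp_id σ.nat)
  assoc σ τ ρ := Hom.ext (Category.assoc σ.nat τ.nat ρ.nat)

/-- `P(X, Y)`. -/
abbrev el (P : StrongProf.{u}) (X Y : FintypeCat.{u}) : Type u := P.prof.el X Y

/-- `P(f, g)`. -/
abbrev bimap (P : StrongProf.{u}) {X X' Y Y' : FintypeCat.{u}} (f : X' ⟶ X) (g : Y ⟶ Y') :
    P.el X Y → P.el X' Y' := P.prof.bimap f g

/-- The component of a strong natural transformation, as a function. -/
def app {P Q : StrongProf.{u}} (τ : P ⟶ Q) (X Y : FintypeCat.{u}) : P.el X Y → Q.el X Y :=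
  FinProf.app (Hom.nat τ) X Y

theorem naturality {P Q : StrongProf.{u}} (τ : P ⟶ Q) {X X' Y Y' : FintypeCat.{u}} (f : X' ⟶ X)
    (g : Y ⟶ Y') (p : P.el X Y) : app τ X' Y' (P.bimap f g p) = Q.bimap f g (app τ X Y p) :=
  FinProf.naturality _ f g p

theorem app_str {P Q : StrongProf.{u}} (τ : P ⟶ Q) (X Y Z : FintypeCat.{u}) (p : P.el X Y) :
    app τ (prod X Z) (prod Y Z) (P.str X Y Z p) = Q.str X Y Z (app τ X Y p) :=
  Hom.nat_str τ X Y Z p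

theorem hom_ext {P Q : StrongProf.{u}} {σ τ : P ⟶ Q} (h : ∀ X Y p, app σ X Y p = app τ X Y p) :
    σ = τ :=
  Hom.ext (NatTrans.ext (by funext A; ext p; exact h A.1.unop A.2 p))

@[simp]
theorem id_app (P : StrongProf.{u}) (X Y : FintypeCat.{u}) (p : P.el X Y) : app (𝟙 P) X Y p = p :=
  rfl

@[simp]
theorem comp_app {P Q R : StrongProf.{u}} (σ : P ⟶ Q) (τ : Q ⟶ R) (X Y : FintypeCat.{u})
    (p : P.el X Y) : app (σ ≫ τ) X Y p = app τ X Y (app σ X Y p) := rfl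

/-- A strong natural transformation from its components. -/
def homMk {P Q : StrongProf.{u}} (app : ∀ X Y, P.el X Y → Q.el X Y)
    (nat : ∀ (X X' Y Y' : FintypeCat.{u}) (f : X' ⟶ X) (g : Y ⟶ Y') (p : P.el X Y),
      app X' Y' (P.bimap f g p) = Q.bimap f g (app X Y p))
    (nat_str : ∀ (X Y Z : FintypeCat.{u}) (p : P.el X Y),
      app (prod X Z) (prod Y Z) (P.str X Y Z p) = Q.str X Y Z (app X Y p)) : P ⟶ Q where
  nat :=
    { app := fun A => TypeCat.ofHom (app A.1.unop A.2)
      naturality := fun A B f => by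
        ext p
        exact nat A.1.unop B.1.unop A.2 B.2 f.1.unop f.2 p }
  nat_str := nat_str

@[simp]
theorem homMk_app {P Q : StrongProf.{u}} (a : ∀ X Y, P.el X Y → Q.el X Y)
    (nat : ∀ (X X' Y Y' : FintypeCat.{u}) (f : X' ⟶ X) (g : Y ⟶ Y') (p : P.el X Y),
      a X' Y' (P.bimap f g p) = Q.bimap f g (a X Y p))
    (nat_str : ∀ (X Y Z : FintypeCat.{u}) (p : P.el X Y),
      a (prod X Z) (prod Y Z) (P.str X Y Z p) = Q.str X Y Z (a X Y p)) (X Y : FintypeCat.{u})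
    (p : P.el X Y) : app (homMk a nat nat_str) X Y p = a X Y p := rfl

/-- A strong natural isomorphism from a strong natural transformation and pointwise inverses. -/
def isoMk {P Q : StrongProf.{u}} (τ : P ⟶ Q) (inv : ∀ X Y, Q.el X Y → P.el X Y)
    (h₁ : ∀ X Y p, inv X Y (app τ X Y p) = p) (h₂ : ∀ X Y q, app τ X Y (inv X Y q) = q) :
    P ≅ Q where
  hom := τ
  inv := homMk inv
    (fun X X' Y Y' f g q => by
      rw [← h₁ X' Y' (P.bimap f g (inv X Y q)), naturality, h₂])
    (fun X Y Z q => by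
      rw [← h₁ _ _ (P.str X Y Z (inv X Y q)), app_str, h₂])
  hom_inv_id := hom_ext fun X Y p => h₁ X Y p
  inv_hom_id := hom_ext fun X Y q => h₂ X Y q

@[simp]
theorem isoMk_hom {P Q : StrongProf.{u}} (τ : P ⟶ Q) (inv : ∀ X Y, Q.el X Y → P.el X Y)
    (h₁ : ∀ X Y p, inv X Y (app τ X Y p) = p) (h₂ : ∀ X Y q, app τ X Y (inv X Y q) = q) :
    (isoMk τ inv h₁ h₂).hom = τ := rfl

/-! #### Bénabou's tensor -/

/-- The strength of `P ⊗ Q`: the map with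
`str ∘ ι_W = ι_{W × Z} ∘ (str^P × str^Q)`. -/
noncomputable def tensorStr (P Q : StrongProf.{u}) (X Y Z : FintypeCat.{u}) :
    Ten P.prof Q.prof X Y → Ten P.prof Q.prof (prod X Z) (prod Y Z) :=
  tlift (fun W p q => tmk (prod W Z) (P.str X W Z p) (Q.str W Y Z q)) (by
    intro V W f p q
    rw [P.str_natural, Q.str_natural]
    exact tmk_bimap _ _ _)

@[simp]
theorem tensorStr_tmk (P Q : StrongProf.{u}) (X Y Z W : FintypeCat.{u}) (p : P.el X W)
    (q : Q.el W Y) : tensorStr P Q X Y Z (tmk W p q) =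
      tmk (prod W Z) (P.str X W Z p) (Q.str W Y Z q) :=
  tlift_tmk _ _ _ _ _

/-- Bénabou's tensor of strong endoprofunctors. -/
noncomputable def tensor (P Q : StrongProf.{u}) : StrongProf.{u} where
  prof := FinProf.tensor P.prof Q.prof
  str := tensorStr P Q
  str_natural Z f g x := by
    induction x using tind with
    | h W p q =>
      simp only [tensor_bimap]
      rw [tbimap_tmk, tensorStr_tmk, tensorStr_tmk, tbimap_tmk, P.str_natural, Q.str_natural]
      rfl
  str_dinatural X Y Z Z' h x := by
    induction x using tind with
    | h W p q =>
      simp only [tensor_bimap]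
      rw [tensorStr_tmk, tensorStr_tmk, tbimap_tmk, tbimap_tmk, Q.str_dinatural, ← tmk_bimap,
        FinProf.bimap_bimap, FinProf.bimap_id, Category.id_comp, Category.id_comp,
        P.str_dinatural]
  str_one X Y x := by
    induction x using tind with
    | h W p q =>
      simp only [tensor_bimap]
      rw [tensorStr_tmk, tbimap_tmk, tbimap_tmk, Q.str_one, ← tmk_bimap,
        FinProf.bimap_bimap, FinProf.bimap_id, Category.id_comp, Category.id_comp, P.str_one]
  str_str X Y V W x := by
    induction x using tind with
    | h U p q =>
      simp only [tensor_bimap]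
      rw [tensorStr_tmk, tensorStr_tmk, tensorStr_tmk, tbimap_tmk, P.str_str, Q.str_str]
      have h := tmk_bimap (P := P.prof) (Q := Q.prof) (assoc U V W)
        (P.bimap (assocInv X V W) (𝟙 _) (P.str X U (prod V W) p))
        (Q.bimap (assocInv U V W) (assoc Y V W) (Q.str U Y (prod V W) q))
      rw [FinProf.bimap_bimap, FinProf.bimap_bimap] at h
      exact h

/-- The class of `(p, q)` in `(P ⊗ Q)(X, Y)`. -/
noncomputable def mkT {P Q : StrongProf.{u}} {X Y : FintypeCat.{u}} (W : FintypeCat.{u})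
    (p : P.el X W) (q : Q.el W Y) : (tensor P Q).el X Y := tmk W p q

theorem mkT_bimap {P Q : StrongProf.{u}} {X Y V W : FintypeCat.{u}} (f : V ⟶ W) (p : P.el X V)
    (q : Q.el W Y) : mkT W (P.bimap (𝟙 X) f p) q = mkT V p (Q.bimap f (𝟙 Y) q) :=
  tmk_bimap f p q

theorem indT {P Q : StrongProf.{u}} {X Y : FintypeCat.{u}} {r : (tensor P Q).el X Y → Prop}
    (h : ∀ W (p : P.el X W) (q : Q.el W Y), r (mkT W p q)) (x : (tensor P Q).el X Y) : r x :=
  tind h x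

/-- Maps out of `(P ⊗ Q)(X, Y)`. -/
noncomputable def liftT {P Q : StrongProf.{u}} {X Y : FintypeCat.{u}} {Z : Type u}
    (φ : ∀ W : FintypeCat.{u}, P.el X W → Q.el W Y → Z)
    (hφ : ∀ (V W : FintypeCat.{u}) (f : V ⟶ W) (p : P.el X V) (q : Q.el W Y),
      φ W (P.bimap (𝟙 X) f p) q = φ V p (Q.bimap f (𝟙 Y) q)) : (tensor P Q).el X Y → Z :=
  tlift φ hφ

@[simp]
theorem liftT_mkT {P Q : StrongProf.{u}} {X Y : FintypeCat.{u}} {Z : Type u}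
    (φ : ∀ W : FintypeCat.{u}, P.el X W → Q.el W Y → Z)
    (hφ : ∀ (V W : FintypeCat.{u}) (f : V ⟶ W) (p : P.el X V) (q : Q.el W Y),
      φ W (P.bimap (𝟙 X) f p) q = φ V p (Q.bimap f (𝟙 Y) q)) (W : FintypeCat.{u}) (p : P.el X W)
    (q : Q.el W Y) : liftT φ hφ (mkT W p q) = φ W p q :=
  tlift_tmk φ hφ W p q

@[simp]
theorem bimap_mkT {P Q : StrongProf.{u}} {X X' Y Y' : FintypeCat.{u}} (f : X' ⟶ X)
    (g : Y ⟶ Y') (W : FintypeCat.{u}) (p : P.el X W) (q : Q.el W Y) :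
    (tensor P Q).bimap f g (mkT W p q) = mkT W (P.bimap f (𝟙 W) p) (Q.bimap (𝟙 W) g q) :=
  tbimap_tmk f g W p q

@[simp]
theorem str_mkT {P Q : StrongProf.{u}} (X Y Z W : FintypeCat.{u}) (p : P.el X W)
    (q : Q.el W Y) : (tensor P Q).str X Y Z (mkT W p q) =
      mkT (prod W Z) (P.str X W Z p) (Q.str W Y Z q) :=
  tensorStr_tmk P Q X Y Z W p q

/-- Functoriality of Bénabou's tensor. -/
noncomputable def tensorMap {P P' Q Q' : StrongProf.{u}} (σ : P ⟶ P') (τ : Q ⟶ Q') :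
    tensor P Q ⟶ tensor P' Q' :=
  homMk (fun X Y => liftT (fun W p q => mkT W (app σ X W p) (app τ W Y q))
      (fun V W f p q => by rw [naturality, naturality, mkT_bimap]))
    (fun X X' Y Y' f g x => by
      induction x using indT with
      | h W p q => rw [bimap_mkT, liftT_mkT, liftT_mkT, bimap_mkT, naturality, naturality])
    (fun X Y Z x => by
      induction x using indT with
      | h W p q => rw [str_mkT, liftT_mkT, liftT_mkT, str_mkT, app_str, app_str])

@[simp]
theorem tensorMap_mkT {P P' Q Q' : StrongProf.{u}} (σ : P ⟶ P') (τ : Q ⟶ Q')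
    (X Y W : FintypeCat.{u}) (p : P.el X W) (q : Q.el W Y) :
    app (tensorMap σ τ) X Y (mkT W p q) = mkT W (app σ X W p) (app τ W Y q) := by
  rw [tensorMap, homMk_app, liftT_mkT]

theorem bimap_id (P : StrongProf.{u}) {X Y : FintypeCat.{u}} (p : P.el X Y) :
    P.bimap (𝟙 X) (𝟙 Y) p = p := FinProf.bimap_id _ p

theorem bimap_comp (P : StrongProf.{u}) {X X' X'' Y Y' Y'' : FintypeCat.{u}} (f : X' ⟶ X)
    (g : Y ⟶ Y') (f' : X'' ⟶ X') (g' : Y' ⟶ Y'') (p : P.el X Y) :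
    P.bimap f' g' (P.bimap f g p) = P.bimap (f' ≫ f) (g ≫ g') p :=
  FinProf.bimap_bimap _ f g f' g' p

/-- The associator `[W, [V, p, q], r] ↦ [V, p, [W, q, r]]`. -/
noncomputable def assocIso (P Q R : StrongProf.{u}) :
    tensor (tensor P Q) R ≅ tensor P (tensor Q R) :=
  isoMk
    (homMk
      (fun X Y => liftT
        (fun W x r => liftT (fun V p q => mkT V p (mkT W q r))
          (fun U V f p q => by rw [mkT_bimap, bimap_mkT, bimap_id]) x)
        (fun V W f x r => by
          induction x using indT with
          | h U p q => rw [bimap_mkT, liftT_mkT, liftT_mkT, mkT_bimap, bimap_id, mkT_bimap]))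
      (fun X X' Y Y' f g x => by
        induction x using indT with
        | h W x r =>
          induction x using indT with
          | h V p q =>
            rw [bimap_mkT, bimap_mkT, liftT_mkT, liftT_mkT, liftT_mkT, liftT_mkT, bimap_mkT,
              bimap_mkT])
      (fun X Y Z x => by
        induction x using indT with
        | h W x r =>
          induction x using indT with
          | h V p q =>
            rw [str_mkT, str_mkT, liftT_mkT, liftT_mkT, liftT_mkT, liftT_mkT, str_mkT, str_mkT]))
    (fun X Y => liftT
        (fun V p x => liftT (fun W q r => mkT W (mkT V p q) r)
          (fun U W f q r => by rw [← mkT_bimap, bimap_mkT, bimap_id]) x)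
        (fun U V f p x => by
          induction x using indT with
          | h W q r => rw [bimap_mkT, liftT_mkT, liftT_mkT, mkT_bimap, bimap_id]))
    (fun X Y x => by
      induction x using indT with
      | h W x r =>
        induction x using indT with
        | h V p q => rw [homMk_app, liftT_mkT, liftT_mkT, liftT_mkT, liftT_mkT])
    (fun X Y x => by
      induction x using indT with
      | h V p x =>
        induction x using indT with
        | h W q r => rw [homMk_app, liftT_mkT, liftT_mkT, liftT_mkT, liftT_mkT])

@[simp]
theorem assocIso_mkT {P Q R : StrongProf.{u}} (X Y V W : FintypeCat.{u}) (p : P.el X V)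
    (q : Q.el V W) (r : R.el W Y) :
    app (assocIso P Q R).hom X Y (mkT W (mkT V p q) r) = mkT V p (mkT W q r) := by
  rw [assocIso, isoMk_hom, homMk_app, liftT_mkT, liftT_mkT]

/-- The unit `Hom`, with strength `f ↦ f × id`. -/
def unit : StrongProf.{u} where
  prof := FinProf.hom
  str _ _ Z := fun f => prodMap f (𝟙 Z)
  str_natural _ _ _ _ := rfl
  str_dinatural _ _ _ _ _ _ := rfl
  str_one _ _ _ := rfl
  str_str _ _ _ _ _ := rfl

/-- A function as an element of `Hom(X, Y)`. -/
def toHom {X Y : FintypeCat.{u}} (f : X ⟶ Y) : unit.el X Y := f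

/-- An element of `Hom(X, Y)` as a function. -/
def ofHom {X Y : FintypeCat.{u}} (f : unit.el X Y) : X ⟶ Y := f

@[simp]
theorem ofHom_toHom {X Y : FintypeCat.{u}} (f : X ⟶ Y) : ofHom (toHom f) = f := rfl

@[simp]
theorem toHom_ofHom {X Y : FintypeCat.{u}} (f : unit.el X Y) : toHom (ofHom f) = f := rfl

theorem unit_bimap {X X' Y Y' : FintypeCat.{u}} (f : X' ⟶ X) (g : Y ⟶ Y') (h : unit.el X Y) :
    unit.bimap f g h = toHom (f ≫ ofHom h ≫ g) := rfl

theorem unit_str {X Y Z : FintypeCat.{u}} (h : unit.el X Y) :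
    unit.str X Y Z h = toHom (prodMap (ofHom h) (𝟙 Z)) := rfl

theorem str_left (P : StrongProf.{u}) {X X' Y : FintypeCat.{u}} (Z : FintypeCat.{u}) (f : X' ⟶ X)
    (p : P.el X Y) : P.str X' Y Z (P.bimap f (𝟙 Y) p) =
      P.bimap (prodMap f (𝟙 Z)) (𝟙 (prod Y Z)) (P.str X Y Z p) := P.str_natural Z f (𝟙 Y) p

theorem str_right (P : StrongProf.{u}) {X Y Y' : FintypeCat.{u}} (Z : FintypeCat.{u}) (g : Y ⟶ Y')
    (p : P.el X Y) : P.str X Y' Z (P.bimap (𝟙 X) g p) =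
      P.bimap (𝟙 (prod X Z)) (prodMap g (𝟙 Z)) (P.str X Y Z p) := P.str_natural Z (𝟙 X) g p

/-- The left unitor `Hom ⊗ Q ≅ Q`, `[W, f, q] ↦ Q(f, id)(q)`. -/
noncomputable def leftIso (Q : StrongProf.{u}) : tensor unit Q ≅ Q :=
  isoMk
    (homMk
      (fun X Y => liftT (fun W f q => Q.bimap (ofHom f) (𝟙 Y) q) (fun V W k f q => by
        rw [bimap_comp, unit_bimap, ofHom_toHom, Category.id_comp, Category.id_comp]))
      (fun X X' Y Y' f g x => by
        induction x using indT with
        | h W k q =>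
          rw [bimap_mkT, liftT_mkT, liftT_mkT, bimap_comp, bimap_comp, unit_bimap, ofHom_toHom,
            Category.comp_id, Category.comp_id, Category.comp_id, Category.id_comp])
      (fun X Y Z x => by
        induction x using indT with
        | h W k q => rw [str_mkT, liftT_mkT, liftT_mkT, str_left, unit_str, ofHom_toHom]))
    (fun X Y q => mkT X (toHom (𝟙 X)) q)
    (fun X Y x => by
      induction x using indT with
      | h W k q =>
        rw [homMk_app, liftT_mkT, ← mkT_bimap, unit_bimap, ofHom_toHom, Category.id_comp,
          Category.id_comp, toHom_ofHom])
    (fun X Y q => by rw [homMk_app, liftT_mkT, ofHom_toHom, bimap_id])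

@[simp]
theorem leftIso_mkT {Q : StrongProf.{u}} (X Y W : FintypeCat.{u}) (f : unit.el X W)
    (q : Q.el W Y) : app (leftIso Q).hom X Y (mkT W f q) = Q.bimap (ofHom f) (𝟙 Y) q := by
  rw [leftIso, isoMk_hom, homMk_app, liftT_mkT]

/-- The right unitor `P ⊗ Hom ≅ P`, `[W, p, f] ↦ P(id, f)(p)`. -/
noncomputable def rightIso (P : StrongProf.{u}) : tensor P unit ≅ P :=
  isoMk
    (homMk
      (fun X Y => liftT (fun W p f => P.bimap (𝟙 X) (ofHom f) p) (fun V W k p f => by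
        rw [bimap_comp, unit_bimap, ofHom_toHom, Category.id_comp, Category.comp_id]))
      (fun X X' Y Y' f g x => by
        induction x using indT with
        | h W p k =>
          rw [bimap_mkT, liftT_mkT, liftT_mkT, bimap_comp, bimap_comp, unit_bimap, ofHom_toHom,
            Category.comp_id, Category.id_comp, Category.id_comp, Category.id_comp])
      (fun X Y Z x => by
        induction x using indT with
        | h W p k => rw [str_mkT, liftT_mkT, liftT_mkT, str_right, unit_str, ofHom_toHom]))
    (fun X Y p => mkT Y p (toHom (𝟙 Y)))
    (fun X Y x => by
      induction x using indT with
      | h W p k =>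
        rw [homMk_app, liftT_mkT, mkT_bimap, unit_bimap, ofHom_toHom, Category.comp_id,
          Category.comp_id, toHom_ofHom])
    (fun X Y p => by rw [homMk_app, liftT_mkT, ofHom_toHom, bimap_id])

@[simp]
theorem rightIso_mkT {P : StrongProf.{u}} (X Y W : FintypeCat.{u}) (p : P.el X W)
    (f : unit.el W Y) : app (rightIso P).hom X Y (mkT W p f) = P.bimap (𝟙 X) (ofHom f) p := by
  rw [rightIso, isoMk_hom, homMk_app, liftT_mkT]

/-- Bénabou's monoidal structure `(Prof_s, ⊗, Hom)`. -/
noncomputable instance : MonoidalCategory StrongProf.{u} where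
  tensorObj := tensor
  whiskerLeft P _ _ τ := tensorMap (𝟙 P) τ
  whiskerRight σ Q := tensorMap σ (𝟙 Q)
  tensorHom := tensorMap
  tensorUnit := unit
  associator := assocIso
  leftUnitor := leftIso
  rightUnitor := rightIso
  tensorHom_def σ τ := hom_ext fun X Y x => by
    induction x using indT with
    | h W p q => simp only [comp_app, tensorMap_mkT, id_app]
  id_tensorHom_id P Q := hom_ext fun X Y x => by
    induction x using indT with
    | h W p q => exact tensorMap_mkT _ _ _ _ _ _ _
  tensorHom_comp_tensorHom σ τ σ' τ' := hom_ext fun X Y x => by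
    induction x using indT with
    | h W p q => simp only [comp_app, tensorMap_mkT]
  whiskerLeft_id P Q := hom_ext fun X Y x => by
    induction x using indT with
    | h W p q => exact tensorMap_mkT _ _ _ _ _ _ _
  id_whiskerRight P Q := hom_ext fun X Y x => by
    induction x using indT with
    | h W p q => exact tensorMap_mkT _ _ _ _ _ _ _
  associator_naturality σ τ ρ := hom_ext fun X Y x => by
    induction x using indT with
    | h W x r =>
      induction x using indT with
      | h V p q => simp only [comp_app, tensorMap_mkT, assocIso_mkT]
  leftUnitor_naturality τ := hom_ext fun X Y x => by
    induction x using indT with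
    | h W p q => simp only [comp_app, tensorMap_mkT, id_app, leftIso_mkT, naturality]
  rightUnitor_naturality τ := hom_ext fun X Y x => by
    induction x using indT with
    | h W p q => simp only [comp_app, tensorMap_mkT, id_app, rightIso_mkT, naturality]
  pentagon P Q R S := hom_ext fun X Y x => by
    induction x using indT with
    | h W x s =>
      induction x using indT with
      | h V x r =>
        induction x using indT with
        | h U p q => simp only [comp_app, tensorMap_mkT, id_app, assocIso_mkT]
  triangle P Q := hom_ext fun X Y x => by
    induction x using indT with
    | h W x q =>
      induction x using indT with
      | h V p f =>
        simp only [comp_app, tensorMap_mkT, id_app, assocIso_mkT, leftIso_mkT, rightIso_mkT,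
          mkT_bimap]

/-! ### The Kleisli adjunction -/

/-- The strong endoprofunctor `F_*(X, Y) = (i X → F Y)`, with strength
`f ↦ ((x, z) ↦ F(y ↦ (y, z))(f x))`. -/
def kleisliObj (F : FinFun.{u}) : StrongProf.{u} where
  prof := FinProf.kleisli F
  str _ Y Z := fun f x => F.map (FintypeCat.homMk fun y => (y, x.2) : Y ⟶ prod Y Z) (f x.1)
  str_natural _ _ _ _ := funext fun _ => by
    change F.map _ (F.map _ _) = F.map _ (F.map _ _)
    rw [← F.map_comp, ← F.map_comp]
    rfl
  str_dinatural _ _ _ _ _ _ := funext fun _ => (F.map_comp _ _ _).symm.trans (F.map_id _).symm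
  str_one _ _ _ := funext fun _ => (F.map_comp _ _ _).symm
  str_str X Y V W f := funext fun x => by
    change F.map _ (F.map _ _) = F.map _ (F.map _ _)
    rw [← F.map_comp, ← F.map_comp]
    rfl

/-- A function `X → F Y` as an element of `F_*(X, Y)`. -/
def kmk {F : FinFun.{u}} {X Y : FintypeCat.{u}} (f : X → F.obj Y) : (kleisliObj F).el X Y := f

/-- Evaluation of an element of `F_*(X, Y)`. -/
def kapp {F : FinFun.{u}} {X Y : FintypeCat.{u}} (f : (kleisliObj F).el X Y) : X → F.obj Y := f

theorem kext {F : FinFun.{u}} {X Y : FintypeCat.{u}} {f g : (kleisliObj F).el X Y}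
    (h : ∀ x, kapp f x = kapp g x) : f = g := funext h

@[simp]
theorem kapp_kmk {F : FinFun.{u}} {X Y : FintypeCat.{u}} (f : X → F.obj Y) (x : X) :
    kapp (kmk f) x = f x := rfl

@[simp]
theorem kapp_bimap {F : FinFun.{u}} {X X' Y Y' : FintypeCat.{u}} (f : X' ⟶ X) (g : Y ⟶ Y')
    (k : (kleisliObj F).el X Y) (x : X') :
    kapp ((kleisliObj F).bimap f g k) x = F.map g (kapp k (f x)) := rfl

@[simp]
theorem kapp_str {F : FinFun.{u}} {X Y Z : FintypeCat.{u}} (k : (kleisliObj F).el X Y)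
    (x : prod X Z) : kapp ((kleisliObj F).str X Y Z k) x =
      F.map (FintypeCat.homMk fun y => (y, x.2) : Y ⟶ prod Y Z) (kapp k x.1) := rfl

/-- The Kleisli functor on morphisms: postcomposition with `τ_Y`. -/
def kleisliMap {F G : FinFun.{u}} (τ : F ⟶ G) : kleisliObj F ⟶ kleisliObj G :=
  homMk (fun _ Y f => kmk fun x => FinFun.app τ Y (kapp f x))
    (fun X X' Y Y' f g k => kext fun x => by
      rw [kapp_kmk, kapp_bimap, kapp_bimap, kapp_kmk, FinFun.naturality])
    (fun X Y Z k => kext fun x => by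
      rw [kapp_kmk, kapp_str, kapp_str, kapp_kmk, FinFun.naturality])

@[simp]
theorem kapp_kleisliMap {F G : FinFun.{u}} (τ : F ⟶ G) {X Y : FintypeCat.{u}}
    (f : (kleisliObj F).el X Y) (x : X) :
    kapp (app (kleisliMap τ) X Y f) x = FinFun.app τ Y (kapp f x) := rfl

/-- The Kleisli functor `(-)_* : [𝔽, 𝕊] ⥤ Prof_s`, `F_*(X, Y) = (i X → F Y)`. -/
def kleisli : FinFun.{u} ⥤ StrongProf.{u} where
  obj := kleisliObj
  map := kleisliMap
  map_id _ := hom_ext fun _ _ _ => kext fun _ => rfl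
  map_comp _ _ := hom_ext fun _ _ _ => kext fun _ => rfl

/-- The finitary functor `P^*(Z) = P(1, Z)`. -/
def restrictObj (P : StrongProf.{u}) : FinFun.{u} :=
  FinFun.mk (fun Z => P.el one Z) (fun f => P.bimap (𝟙 one) f) (fun _ p => P.bimap_id p)
    (fun f g p => (P.bimap_comp (𝟙 one) f (𝟙 one) g p).symm)

/-- An element of `P(1, Z)` as an element of `P^*(Z)`. -/
def rmk {P : StrongProf.{u}} {Z : FintypeCat.{u}} (p : P.el one Z) : (restrictObj P).obj Z := p

/-- An element of `P^*(Z)` as an element of `P(1, Z)`. -/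
def rval {P : StrongProf.{u}} {Z : FintypeCat.{u}} (p : (restrictObj P).obj Z) : P.el one Z := p

@[simp]
theorem rval_rmk {P : StrongProf.{u}} {Z : FintypeCat.{u}} (p : P.el one Z) : rval (rmk p) = p :=
  rfl

@[simp]
theorem rmk_rval {P : StrongProf.{u}} {Z : FintypeCat.{u}} (p : (restrictObj P).obj Z) :
    rmk (rval p) = p := rfl

theorem restrictObj_map {P : StrongProf.{u}} {Z Z' : FintypeCat.{u}} (f : Z ⟶ Z')
    (p : (restrictObj P).obj Z) : (restrictObj P).map f p = rmk (P.bimap (𝟙 one) f (rval p)) := rfl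

/-- The restriction functor on morphisms: `(τ^*)_Z = τ_{1,Z}`. -/
def restrictMap {P Q : StrongProf.{u}} (τ : P ⟶ Q) : restrictObj P ⟶ restrictObj Q :=
  FinFun.homMk (fun Z p => rmk (app τ one Z (rval p))) (fun X Y f p => by
    rw [restrictObj_map, restrictObj_map, rval_rmk, rval_rmk, naturality])

@[simp]
theorem restrictMap_app {P Q : StrongProf.{u}} (τ : P ⟶ Q) (Z : FintypeCat.{u})
    (p : (restrictObj P).obj Z) :
    FinFun.app (restrictMap τ) Z p = rmk (app τ one Z (rval p)) := rfl

/-- The functor `(-)^* : Prof_s ⥤ [𝔽, 𝕊]`, `P^*(Z) = P(1, Z)`. -/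
def restrict : StrongProf.{u} ⥤ FinFun.{u} where
  obj := restrictObj
  map := restrictMap
  map_id _ := FinFun.hom_ext fun _ _ => rfl
  map_comp _ _ := FinFun.hom_ext fun _ _ => rfl

/-- The map `1 → X` picking out an element. -/
def pt {X : FintypeCat.{u}} (x : X) : one.{u} ⟶ X := FintypeCat.homMk fun _ => x

theorem bimap_pt_str (P : StrongProf.{u}) (X Y Z : FintypeCat.{u}) (x : X) (z : Z) (p : P.el X Y) :
    P.bimap (pt ((x, z) : prod X Z)) (𝟙 (prod Y Z)) (P.str X Y Z p) =
      P.bimap (pt x) (FintypeCat.homMk fun y => (y, z) : Y ⟶ prod Y Z) p := by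
  have h₁ := congrArg (P.bimap (pt ((x, PUnit.unit) : prod X one)) (𝟙 (prod Y Z)))
    (P.str_dinatural X Y (pt z) p)
  have h₂ := congrArg (P.bimap (pt ((x, PUnit.unit) : prod X one))
    (FintypeCat.homMk fun y => (y, z) : Y ⟶ prod Y Z)) (P.str_one X Y p)
  have e₁ := (P.bimap_comp _ _ _ _ _).symm.trans (h₁.trans (P.bimap_comp _ _ _ _ _))
  have e₂ := (P.bimap_comp _ _ _ _ _).symm.trans (h₂.trans (P.bimap_comp _ _ _ _ _))
  exact e₁.symm.trans e₂

/-- The unit `P(X, Y) → (X → P(1, Y))`, `p ↦ (x ↦ P(x, id)(p))`. -/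
def kleisliUnit (P : StrongProf.{u}) : P ⟶ kleisliObj (restrictObj P) :=
  homMk (fun _ Y p => kmk fun x => rmk (P.bimap (pt x) (𝟙 Y) p))
    (fun X X' Y Y' f g p => kext fun x => by
      rw [kapp_kmk, kapp_bimap, kapp_kmk, restrictObj_map, rval_rmk, bimap_comp, bimap_comp]
      rfl)
    (fun X Y Z p => kext fun x => by
      rw [kapp_kmk, kapp_str, kapp_kmk, restrictObj_map, rval_rmk, bimap_comp]
      exact congrArg rmk (P.bimap_pt_str X Y Z x.1 x.2 p))

@[simp]
theorem kapp_kleisliUnit {P : StrongProf.{u}} {X Y : FintypeCat.{u}} (p : P.el X Y) (x : X) :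
    kapp (app (kleisliUnit P) X Y p) x = rmk (P.bimap (pt x) (𝟙 Y) p) := rfl

/-- The counit `(1 → F Z) → F Z`, evaluation at the element of `1`. -/
def kleisliCounit (F : FinFun.{u}) : restrictObj (kleisliObj F) ⟶ F :=
  FinFun.homMk (fun _ f => kapp (rval f) PUnit.unit) (fun X Y f p => by
    rw [restrictObj_map, rval_rmk, kapp_bimap])

@[simp]
theorem kleisliCounit_app {F : FinFun.{u}} {Z : FintypeCat.{u}}
    (f : (restrictObj (kleisliObj F)).obj Z) :
    FinFun.app (kleisliCounit F) Z f = kapp (rval f) PUnit.unit := rfl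

/-- The Kleisli adjunction `(-)^* ⊣ (-)_*`. -/
def kleisliAdjunction : restrict.{u} ⊣ kleisli.{u} where
  unit :=
    { app := kleisliUnit
      naturality := fun P Q τ => hom_ext (P := P) (Q := kleisliObj (restrictObj Q))
        fun _ Y p => kext fun x => congrArg rmk (naturality τ (pt x) (𝟙 Y) p).symm }
  counit :=
    { app := kleisliCounit
      naturality := fun F G _ => FinFun.hom_ext (F := restrictObj (kleisliObj F)) (G := G)
        fun _ _ => rfl }
  left_triangle_components P := FinFun.hom_ext (F := restrictObj P) (G := restrictObj P)
    fun _ p => P.bimap_id p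
  right_triangle_components F := hom_ext (P := kleisliObj F) (Q := kleisliObj F)
    fun _ _ _ => kext fun _ => F.map_id _

end StrongProf

end FinComp

/-!
Restriction is opmonoidal by explicit maps: `φ_{P,Q}` sends the class of `p ∈ P(1, W)`,
`q ∈ Q(W, Z)` to the class of `p` together with the function `W → Q(1, Z)`, `w ↦ Q(w, id)(q)`, and
`φ₀` sends `1 → Z` to its value (`restrictTensor` and `restrictUnit`). The coherence laws hold on
coend representatives; for associativity both composites send `[W, [V, p, q], r]` to
`[V, p, v ↦ [W, Q(v, id)(q), w ↦ R(w, id)(r)]]`.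

The lax monoidal structure on the Kleisli functor is the mate of this one under the Kleisli
adjunction, by doctrinal adjunction: `ξ₀ = (φ₀)_* ∘ η` and `ξ_{F,G}` is the transpose of
`(ε_F ∘ ε_G) ∘ φ_{F_*,G_*}`, where `ε` is the counit; on representatives it sends `[W, f, g]` to
`x ↦ [W, f x, g]`. The two compatibility equations of a
colax-lax adjunction then hold for every mate pair.
-/

namespace FinComp.StrongProf

/-- Compatibility of `(p, q) ↦ [p, w ↦ Q(w, id)(q)]` with the coend relation of `P ⊗ Q`. -/
theorem smk_bimap {P Q : StrongProf.{u}} {V W Z : FintypeCat.{u}} (f : V ⟶ W) (p : P.el one V)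
    (q : Q.el W Z) :
    (FinFun.smk W (rmk (P.bimap (𝟙 one) f p)) fun w => rmk (Q.bimap (pt w) (𝟙 Z) q) :
        (FinFun.subst (restrictObj P) (restrictObj Q)).obj Z) =
      FinFun.smk V (rmk p) fun v => rmk (Q.bimap (pt v) (𝟙 Z) (Q.bimap f (𝟙 Z) q)) := by
  have h : ∀ v : V, Q.bimap (pt v) (𝟙 Z) (Q.bimap f (𝟙 Z) q) = Q.bimap (pt (f v)) (𝟙 Z) q :=
    fun v => Q.bimap_comp f (𝟙 Z) (pt v) (𝟙 Z) q
  simp only [h]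
  exact FinFun.smk_map f (rmk p) _

/-- The map `(P ⊗ Q)^* ⟶ P^* ∘ Q^*`, `[W, p, q] ↦ [W, p, w ↦ Q(w, id)(q)]`. -/
noncomputable def restrictTensor (P Q : StrongProf.{u}) :
    restrictObj (tensor P Q) ⟶ FinFun.subst (restrictObj P) (restrictObj Q) :=
  FinFun.homMk
    (fun Z x => liftT
      (fun W p q => FinFun.smk W (rmk p) fun w => rmk (Q.bimap (pt w) (𝟙 Z) q))
      (fun _ _ f p q => smk_bimap f p q)
      (rval x))
    (fun Z Z' g x => by
      rw [restrictObj_map, rval_rmk]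
      generalize rval x = y
      induction y using indT with
      | h W p q =>
        rw [bimap_mkT, liftT_mkT, liftT_mkT, FinFun.subst_map_smk, bimap_id]
        congr 1
        funext w
        rw [restrictObj_map, rval_rmk, bimap_comp, bimap_comp]
        rfl)

@[simp]
theorem restrictTensor_app {P Q : StrongProf.{u}} (Z W : FintypeCat.{u}) (p : P.el one W)
    (q : Q.el W Z) : FinFun.app (restrictTensor P Q) Z (rmk (mkT W p q)) =
      FinFun.smk W (rmk p) fun w => rmk (Q.bimap (pt w) (𝟙 Z) q) := by
  rw [restrictTensor, FinFun.homMk_app, rval_rmk, liftT_mkT]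

/-- The map `Hom^* ⟶ i`, evaluation at the element of `1`. -/
def restrictUnit : restrictObj unit.{u} ⟶ FinFun.incl.{u} :=
  FinFun.homMk (fun _ f => FinFun.toIncl (ofHom (rval f) PUnit.unit)) (fun _ _ _ _ => rfl)

@[simp]
theorem restrictUnit_app (Z : FintypeCat.{u}) (f : (restrictObj unit.{u}).obj Z) :
    FinFun.app restrictUnit Z f = FinFun.toIncl (ofHom (rval f) PUnit.unit) := rfl

/-- Elements of `(P ⊗ Q)^*(Z)` are represented by pairs in `P(1, W) × Q(W, Z)`. -/
theorem restrict_indT {P Q : StrongProf.{u}} {Z : FintypeCat.{u}}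
    {r : (restrictObj (tensor P Q)).obj Z → Prop}
    (h : ∀ W (p : P.el one W) (q : Q.el W Z), r (rmk (mkT W p q)))
    (x : (restrictObj (tensor P Q)).obj Z) : r x :=
  indT (r := fun y => r (rmk y)) h (rval x)

theorem restrictTensor_naturality {P P' Q Q' : StrongProf.{u}} (σ : P ⟶ P') (τ : Q ⟶ Q') :
    restrictTensor P Q ≫ FinFun.substMap (restrictMap σ) (restrictMap τ) =
      restrictMap (tensorMap σ τ) ≫ restrictTensor P' Q' :=
  FinFun.hom_ext fun Z x => by
    induction x using restrict_indT with
    | h W p q =>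
      simp only [FinFun.comp_app, restrictTensor_app, FinFun.substMap_smk, restrictMap_app,
        rval_rmk, tensorMap_mkT, naturality]

theorem restrictTensor_assoc (P Q R : StrongProf.{u}) :
    restrictTensor (tensor P Q) R ≫
        FinFun.substMap (restrictTensor P Q) (𝟙 (restrictObj R)) ≫
          (FinFun.assocIso (restrictObj P) (restrictObj Q) (restrictObj R)).hom =
      restrictMap (assocIso P Q R).hom ≫ restrictTensor P (tensor Q R) ≫
        FinFun.substMap (𝟙 (restrictObj P)) (restrictTensor Q R) :=
  FinFun.hom_ext fun Z x => by
    induction x using restrict_indT with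
    | h W x r =>
      induction x using indT with
      | h V p q =>
        simp only [FinFun.comp_app, restrictTensor_app, FinFun.substMap_smk, FinFun.id_app,
          FinFun.assocIso_smk, restrictMap_app, rval_rmk, assocIso_mkT, bimap_mkT, bimap_id]

theorem restrictTensor_leftIso (Q : StrongProf.{u}) :
    restrictTensor unit Q ≫ FinFun.substMap restrictUnit (𝟙 (restrictObj Q)) ≫
        (FinFun.leftIso (restrictObj Q)).hom = restrictMap (leftIso Q).hom :=
  FinFun.hom_ext fun Z x => by
    induction x using restrict_indT with
    | h W f q =>
      simp only [FinFun.comp_app, restrictTensor_app, FinFun.substMap_smk, FinFun.id_app,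
        FinFun.leftIso_smk, restrictMap_app, rval_rmk, leftIso_mkT, restrictUnit_app,
        FinFun.ofIncl_toIncl]
      rfl

theorem restrictTensor_rightIso (P : StrongProf.{u}) :
    restrictTensor P unit ≫ FinFun.substMap (𝟙 (restrictObj P)) restrictUnit ≫
        (FinFun.rightIso (restrictObj P)).hom = restrictMap (rightIso P).hom :=
  FinFun.hom_ext fun Z x => by
    induction x using restrict_indT with
    | h W p f =>
      simp only [FinFun.comp_app, restrictTensor_app, FinFun.substMap_smk, FinFun.id_app,
        FinFun.rightIso_smk, restrictMap_app, rval_rmk, rightIso_mkT, restrictUnit_app,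
        FinFun.ofIncl_toIncl]
      rfl

/-- The opmonoidal structure of the restriction functor. -/
noncomputable instance restrictOplaxMonoidal : restrict.{u}.OplaxMonoidal where
  η := restrictUnit
  δ := restrictTensor
  δ_natural_left {P P'} σ Q := by
    refine Eq.trans ?_ (restrictTensor_naturality σ (𝟙 Q))
    exact congrArg (fun t => restrictTensor P Q ≫ FinFun.substMap (restrictMap σ) t)
      (restrict.map_id Q).symm
  δ_natural_right {Q Q'} P τ := by
    refine Eq.trans ?_ (restrictTensor_naturality (𝟙 P) τ)
    exact congrArg (fun t => restrictTensor P Q ≫ FinFun.substMap t (restrictMap τ))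
      (restrict.map_id P).symm
  oplax_associativity := restrictTensor_assoc
  oplax_left_unitality Q :=
    (Iso.eq_inv_comp (restrict.mapIso (λ_ Q))).2 <| (Iso.comp_inv_eq _).2 <|
      (restrictTensor_leftIso Q).symm
  oplax_right_unitality P :=
    (Iso.eq_inv_comp (restrict.mapIso (ρ_ P))).2 <| (Iso.comp_inv_eq _).2 <|
      (restrictTensor_rightIso P).symm

end FinComp.StrongProf

theorem mainTheorem7 :
    ∃ (_ : FinComp.StrongProf.kleisli.{u}.LaxMonoidal)
      (_ : FinComp.StrongProf.restrict.{u}.OplaxMonoidal),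
      FinComp.StrongProf.kleisliAdjunction.{u}.unit.app (𝟙_ FinComp.StrongProf.{u}) ≫
          FinComp.StrongProf.kleisli.{u}.map
            (Functor.OplaxMonoidal.η FinComp.StrongProf.restrict.{u}) =
        Functor.LaxMonoidal.ε FinComp.StrongProf.kleisli.{u} ∧
      ∀ P Q : FinComp.StrongProf.{u},
        FinComp.StrongProf.kleisliAdjunction.{u}.unit.app (P ⊗ Q) ≫
            FinComp.StrongProf.kleisli.{u}.map
              (Functor.OplaxMonoidal.δ FinComp.StrongProf.restrict.{u} P Q) =
          (FinComp.StrongProf.kleisliAdjunction.{u}.unit.app P ⊗ₘ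
              FinComp.StrongProf.kleisliAdjunction.{u}.unit.app Q) ≫
            Functor.LaxMonoidal.μ FinComp.StrongProf.kleisli.{u}
              (FinComp.StrongProf.restrict.{u}.obj P) (FinComp.StrongProf.restrict.{u}.obj Q) := by
  let : FinComp.StrongProf.kleisli.{u}.LaxMonoidal :=
    FinComp.StrongProf.kleisliAdjunction.rightAdjointLaxMonoidal
  exact ⟨inferInstance, inferInstance,
    FinComp.StrongProf.kleisliAdjunction.unit_app_unit_comp_map_η,
    FinComp.StrongProf.kleisliAdjunction.unit_app_tensor_comp_map_δ⟩
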